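/- For $0<q<1$ put $\theta_2(q)=\sum_{n\in\mathbb Z}q^{(n+1/2)^2}$, $\theta_3(q)=\sum_{n\in\mathbb Z}q^{n^2}$, and let $k(q)=\theta_2(q)^2/\theta_3(q)^2$ and $k'(q)=\sqrt{1-k(q)^2}$ be the elliptic modulus and the complementary elliptic modulus. For $\alpha,t>0$ let $$p_\alpha(x,y;t)=\sum_{(k,l)\in\mathbb Z^2}e^{-\pi t(\alpha^2k^2+\alpha^{-2}l^2)}\,e^{2\pi i(kx+ly)},\qquad (x,y)\in\mathbb R^2,$$ be the (real-valued, $\mathbb Z^2$-periodic) heat kernel of the rectangular torus $\mathbb R^2/(\alpha^{-1}\mathbb Z\times\alpha\mathbb Z)$ of area $1$, written in the rescaled coordinates $x=\alpha(x_1-x_2)$, $y=\alpha^{-1}(y_1-y_2)$ and with time scaled by $\tfrac1{4\pi}$, and let $A(\alpha;t)=\min_{(x,y)}p_\alpha(x,y;t)$ and $B(\alpha;t)=\max_{(x,y)}p_\alpha(x,y;t)$ be the minimal and maximal temperature. For $k'\in(0,1)$ put $k=\sqrt{1-k'^2}$ and $$A(k')=\sqrt{k\,k'\;{}_2F_1\!\left(\tfrac12,\tfrac12;1;k^2\right){}_2F_1\!\left(\tfrac12,\tfrac12;1;k'^2\right)},\qquad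 B(k')=\sqrt{{}_2F_1\!\left(\tfrac12,\tfrac12;1;k^2\right){}_2F_1\!\left(\tfrac12,\tfrac12;1;k'^2\right)}.$$ Then the following hold. 1. For all $k'\in(0,1)$, $A(k')\le A\!\left(\tfrac1{\sqrt2}\right)$ and $B(k')\ge B\!\left(\tfrac1{\sqrt2}\right)$, and in each of the two inequalities equality holds if and only if $k'=k=\tfrac1{\sqrt2}$. 2. These are statements about temperatures: $\alpha\mapsto k'(e^{-\pi\alpha^2})$ is a bijection from $(0,\infty)$ onto $(0,1)$ with $k'(e^{-\pi})=\tfrac1{\sqrt2}$, and for every $\alpha>0$ the minimum and maximum of $p_\alpha(\cdot,\cdot;1)$ are attained and equal $A(\alpha;1)=A\bigl(k'(e^{-\pi\alpha^2})\bigr)$ and $B(\alpha;1)=B\bigl(k'(e^{-\pi\alpha^2})\bigr)$. 3. Hence, among the rectangular tori of area $1$ at time $1$, the square torus uniquely maximizes the minimal temperature and uniquely minimizes the maximal temperature: for all $\alpha>0$, $A(\alpha;1)\le A(1;1)$ and $B(\alpha;1)\ge B(1;1)$, and in each of the two inequalities equality holds if and only if $\alpha=1$. -/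

import Mathlib

namespace RectTorus

noncomputable section

/-- The Fourier series `∑ exp(-π t (α² k² + α⁻² l²)) exp(2πi (k x + l y))` over `(k, l) ∈ ℤ²`: the
heat kernel of the flat torus `ℝ² / (α⁻¹ ℤ × α ℤ)` of area one, in the coordinates
`x = α (x₁ - x₂)`, `y = α⁻¹ (y₁ - y₂)` (periodic with respect to `ℤ²`), with the time scaled by
`1 / (4π)`. -/
def heatKernelC (α x y t : ℝ) : ℂ :=
  ∑' m : ℤ × ℤ,
    Complex.exp (-(Real.pi * t * (α ^ 2 * (m.1 : ℝ) ^ 2 + (α ^ 2)⁻¹ * (m.2 : ℝ) ^ 2) : ℝ)) *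
      Complex.exp (2 * Real.pi * Complex.I * ((m.1 : ℝ) * x + (m.2 : ℝ) * y : ℝ))

/-- The heat kernel is real valued. -/
theorem heatKernelC_im (α x y t : ℝ) : (heatKernelC α x y t).im = 0 := by
  rw [← Complex.conj_eq_iff_im]
  unfold heatKernelC
  rw [Complex.conj_tsum, ← (Equiv.neg (ℤ × ℤ)).tsum_eq]
  refine tsum_congr fun m => ?_
  rw [map_mul, ← Complex.exp_conj, ← Complex.exp_conj]
  simp only [Equiv.neg_apply, Prod.fst_neg, Prod.snd_neg, Int.cast_neg, Complex.ofReal_neg,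
    Complex.ofReal_add, Complex.ofReal_mul, map_neg, map_mul, map_add, Complex.conj_ofReal,
    Complex.conj_I, Complex.ofReal_intCast, Complex.ofReal_pow, map_pow, map_ofNat,
    Complex.ofReal_inv, map_inv₀, map_intCast, neg_sq]
  congr 2
  ring

/-- The heat kernel `p_α(x, y; t)` as a real number. -/
def heatKernel (α x y t : ℝ) : ℝ := (heatKernelC α x y t).re

/-- The set of all temperatures `p_α(x, y; t)` on the torus at time `t`. -/
def temperatures (α t : ℝ) : Set ℝ := Set.range fun z : ℝ × ℝ => heatKernel α z.1 z.2 t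

/-- The minimal temperature `A(α; t)`. -/
def minTemp (α t : ℝ) : ℝ := sInf (temperatures α t)

/-- The maximal temperature `B(α; t)`. -/
def maxTemp (α t : ℝ) : ℝ := sSup (temperatures α t)

/-- The theta-null `θ₂(q)`, for `0 < q < 1`. -/
def theta2 (q : ℝ) : ℝ := ∑' n : ℤ, q ^ (((n : ℝ) + 1 / 2) ^ 2)

/-- The theta-null `θ₃(q)`, for `0 < q < 1`. -/
def theta3 (q : ℝ) : ℝ := ∑' n : ℤ, q ^ ((n : ℝ) ^ 2)

/-- The elliptic modulus `k(q)`. -/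
def modulus (q : ℝ) : ℝ := theta2 q ^ 2 / theta3 q ^ 2

/-- The complementary elliptic modulus `k'(q)`, given by `k² + k'² = 1`. -/
def compModulus (q : ℝ) : ℝ := √(1 - modulus q ^ 2)

/-- `A(k') = √(k k' ₂F₁(1/2, 1/2; 1; k²) ₂F₁(1/2, 1/2; 1; k'²))`, where `k = √(1 - k'²)`. -/
def A (k' : ℝ) : ℝ :=
  √(√(1 - k' ^ 2) * k' * ₂F₁ (1 / 2 : ℝ) (1 / 2 : ℝ) (1 : ℝ) (√(1 - k' ^ 2) ^ 2) *
    ₂F₁ (1 / 2 : ℝ) (1 / 2 : ℝ) (1 : ℝ) (k' ^ 2))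

/-- `B(k') = √(₂F₁(1/2, 1/2; 1; k²) ₂F₁(1/2, 1/2; 1; k'²))`, where `k = √(1 - k'²)`. -/
def B (k' : ℝ) : ℝ :=
  √(₂F₁ (1 / 2 : ℝ) (1 / 2 : ℝ) (1 : ℝ) (√(1 - k' ^ 2) ^ 2) *
    ₂F₁ (1 / 2 : ℝ) (1 / 2 : ℝ) (1 : ℝ) (k' ^ 2))

end

end RectTorus

namespace RectTorus

/-! At time one the kernel factors as θ(x, α²) θ(y, α⁻²), where θ(x, t) is the theta function of the
circle (`heatKernel_eq_mul`). Each factor is largest at 0, term by term. That it is smallest at 1/2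
comes from a duplication identity (`circleTheta_mul_add_half`), iterated until t is so large that θ
is nearly constant (`circleTheta_half_le`). The extremal temperatures are therefore θ₄(t) θ₄(1/t)
and θ₃(t) θ₃(1/t), with t = α².

Let F be ₂F₁(1/2, 1/2; 1; ·). Jacobi's formula F(k²) = θ₃² (`ellipticF_modulus_sq`), together with
the exchange of k and k' under t ↦ 1/t, identifies these products with A(k') and B(k'). Jacobi's
formula itself follows from Gauss's transformation (`ellipticF_gauss`): F(k²)/θ₃² is invariant under
t ↦ 2t and tends to 1 at infinity. It also gives t = F(k'²)/F(k²), hence injectivity of the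
parametrization.

What remains concerns one variable x = k'². Both F(x) F(1 - x) and x (1 - x) (F(x) F(1 - x))² are
symmetric about 1/2, so it suffices to know the sign of the derivative on (0, 1/2). After dividing
by positive factors, this compares F'/F, respectively x U/F with U = F/2 - (1 - x) F', at x and at 1
- x. Both F'/F and U/F increase, because they are quotients of power series whose coefficient ratios
increase (`strictMonoOn_powerSum_div`). -/

open Complex in
/-- The theta series `∑ exp (2 π i (n + 1/2) z + π i (n + 1/2)² τ)`. -/
noncomputable def jacobiThetaHalf (z τ : ℂ) : ℂ :=
  ∑' n : ℤ, cexp (2 * Real.pi * I * (n + 1 / 2) * z + Real.pi * I * (n + 1 / 2) ^ 2 * τ)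

/-! ### Product and duplication formulas for complex theta functions -/

section ComplexTheta
open Complex
local notation "π" => Real.pi

lemma exp_half_eq (n : ℤ) (z τ : ℂ) :
    cexp (2 * π * I * (n + 1 / 2) * z + π * I * (n + 1 / 2) ^ 2 * τ) =
      cexp (π * I * z + π * I * τ / 4) * jacobiTheta₂_term n (z + τ / 2) τ := by
  rw [jacobiTheta₂_term, ← Complex.exp_add]
  congr 1
  ring

lemma jacobiThetaHalf_eq (z τ : ℂ) :
    jacobiThetaHalf z τ = cexp (π * I * z + π * I * τ / 4) * jacobiTheta₂ (z + τ / 2) τ := by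
  simp_rw [jacobiThetaHalf, exp_half_eq, tsum_mul_left, jacobiTheta₂]

lemma hasSum_jacobiThetaHalf (z : ℂ) {τ : ℂ} (hτ : 0 < τ.im) :
    HasSum (fun n : ℤ => cexp (2 * π * I * (n + 1 / 2) * z + π * I * (n + 1 / 2) ^ 2 * τ))
      (jacobiThetaHalf z τ) := by
  rw [jacobiThetaHalf_eq]
  simp_rw [exp_half_eq]
  exact (hasSum_jacobiTheta₂_term _ hτ).mul_left _

lemma jacobiThetaHalf_add_one (z τ : ℂ) : jacobiThetaHalf (z + 1) τ = -jacobiThetaHalf z τ := by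
  rw [jacobiThetaHalf_eq, jacobiThetaHalf_eq, show z + 1 + τ / 2 = z + τ / 2 + 1 by ring,
    jacobiTheta₂_add_left, show π * I * (z + 1) + π * I * τ / 4 =
      π * I * z + π * I * τ / 4 + π * I by ring, Complex.exp_add _ (π * I), Complex.exp_pi_mul_I]
  ring

lemma jacobiThetaHalf_neg (z τ : ℂ) : jacobiThetaHalf (-z) τ = jacobiThetaHalf z τ := by
  rw [jacobiThetaHalf, jacobiThetaHalf, ← ((Equiv.neg ℤ).trans (Equiv.subRight 1)).tsum_eq]
  refine tsum_congr fun n => ?_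
  simp only [Equiv.trans_apply, Equiv.neg_apply, Equiv.subRight_apply]
  push_cast
  ring_nf

lemma jacobiThetaHalf_half (τ : ℂ) : jacobiThetaHalf (1 / 2) τ = 0 := by
  have h := jacobiThetaHalf_add_one (-(1 / 2)) τ
  rw [jacobiThetaHalf_neg, show (-(1 / 2) + 1 : ℂ) = 1 / 2 by norm_num] at h
  exact self_eq_neg.mp h

/-- Pairs of integers split into those with even sum `(a + b, a - b)` and those with odd sum
`(a + b + 1, a - b)`. -/
def parityEquiv : (ℤ × ℤ) ⊕ (ℤ × ℤ) ≃ ℤ × ℤ where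
  toFun := Sum.elim (fun p => (p.1 + p.2, p.1 - p.2)) (fun p => (p.1 + p.2 + 1, p.1 - p.2))
  invFun p := if (p.1 + p.2) % 2 = 0 then Sum.inl ((p.1 + p.2) / 2, (p.1 - p.2) / 2)
    else Sum.inr ((p.1 + p.2) / 2, (p.1 - p.2) / 2)
  left_inv := by
    rintro (⟨a, b⟩ | ⟨a, b⟩)
    · have h : (a + b + (a - b)) % 2 = 0 := by omega
      simp only [Sum.elim_inl, h, if_true, Sum.inl.injEq, Prod.mk.injEq]
      omega
    · have h : ¬(a + b + 1 + (a - b)) % 2 = 0 := by omega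
      simp only [Sum.elim_inr, h, if_false, Sum.inr.injEq, Prod.mk.injEq]
      omega
  right_inv := by
    rintro ⟨a, b⟩
    by_cases h : (a + b) % 2 = 0
    · simp only [h, if_true, Sum.elim_inl, Prod.mk.injEq]
      omega
    · simp only [h, if_false, Sum.elim_inr, Prod.mk.injEq]
      omega

lemma hasSum_mul_prod {f g : ℤ → ℂ} {a b : ℂ} (hf : HasSum f a) (hg : HasSum g b) :
    HasSum (fun p : ℤ × ℤ => f p.1 * g p.2) (a * b) :=
  hf.mul hg (summable_mul_of_summable_norm hf.summable.norm hg.summable.norm)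

/-- The map (a, b) ↦ (a + b, a - b) doubles the quadratic form a² + b² and reaches the index pairs
of even sum. Pairs of odd sum arise in the same way from a + 1/2 and b + 1/2, which produces the
half-integer series. -/
theorem jacobiTheta₂_mul (z w : ℂ) {τ : ℂ} (hτ : 0 < τ.im) :
    jacobiTheta₂ z τ * jacobiTheta₂ w τ =
      jacobiTheta₂ (z + w) (2 * τ) * jacobiTheta₂ (z - w) (2 * τ) +
        jacobiThetaHalf (z + w) (2 * τ) * jacobiThetaHalf (z - w) (2 * τ) := by
  have hτ2 : 0 < (2 * τ).im := by simpa using hτ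
  have h1 := hasSum_mul_prod (hasSum_jacobiTheta₂_term z hτ) (hasSum_jacobiTheta₂_term w hτ)
  have h2 := hasSum_mul_prod (hasSum_jacobiTheta₂_term (z + w) hτ2) (hasSum_jacobiTheta₂_term (z - w) hτ2)
  have h3 := hasSum_mul_prod (hasSum_jacobiThetaHalf (z + w) hτ2) (hasSum_jacobiThetaHalf (z - w) hτ2)
  rw [← parityEquiv.hasSum_iff] at h1
  have h4 : HasSum ((fun p : ℤ × ℤ => jacobiTheta₂_term p.1 z τ * jacobiTheta₂_term p.2 w τ) ∘
      parityEquiv) (jacobiTheta₂ (z + w) (2 * τ) * jacobiTheta₂ (z - w) (2 * τ) +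
        jacobiThetaHalf (z + w) (2 * τ) * jacobiThetaHalf (z - w) (2 * τ)) := by
    refine HasSum.sum (h2.congr_fun ?_) (h3.congr_fun ?_)
    · rintro ⟨a, b⟩
      simp only [Function.comp_apply, parityEquiv, Equiv.coe_fn_mk, Sum.elim_inl,
        jacobiTheta₂_term, ← Complex.exp_add]
      push_cast
      ring_nf
    · rintro ⟨a, b⟩
      simp only [Function.comp_apply, parityEquiv, Equiv.coe_fn_mk, Sum.elim_inr,
        jacobiTheta₂_term, ← Complex.exp_add]
      push_cast
      ring_nf
  exact h1.unique h4

theorem jacobiTheta₂_zero_sq {τ : ℂ} (hτ : 0 < τ.im) :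
    jacobiTheta₂ 0 τ ^ 2 = jacobiTheta₂ 0 (2 * τ) ^ 2 + jacobiThetaHalf 0 (2 * τ) ^ 2 := by
  simpa [sq] using jacobiTheta₂_mul 0 0 hτ

/-- Shifting z + w by 1 changes the sign of the half-integer series only. -/
theorem jacobiTheta₂_half_sq {τ : ℂ} (hτ : 0 < τ.im) :
    jacobiTheta₂ (1 / 2) τ ^ 2 = jacobiTheta₂ 0 (2 * τ) ^ 2 - jacobiThetaHalf 0 (2 * τ) ^ 2 := by
  have h := jacobiTheta₂_mul (1 / 2) (1 / 2) hτ
  have h1 := jacobiTheta₂_add_left 0 (2 * τ)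
  have h2 := jacobiThetaHalf_add_one 0 (2 * τ)
  rw [show (1 / 2 + 1 / 2 : ℂ) = 0 + 1 by norm_num, h1, h2, sub_self] at h
  rw [sq, h]
  ring

theorem jacobiThetaHalf_zero_sq {τ : ℂ} (hτ : 0 < τ.im) :
    jacobiThetaHalf 0 τ ^ 2 = 2 * jacobiThetaHalf 0 (2 * τ) * jacobiTheta₂ 0 (2 * τ) := by
  set E := cexp (π * I * τ / 2) with hE
  have h := jacobiTheta₂_mul (τ / 2) (τ / 2) hτ
  have h1 := jacobiTheta₂_add_left' 0 (2 * τ)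
  have h2 : jacobiThetaHalf 0 (2 * τ) = E * jacobiTheta₂ τ (2 * τ) := by
    rw [jacobiThetaHalf_eq, zero_add, mul_div_cancel_left₀ τ two_ne_zero, hE]
    ring_nf
  have h3 : jacobiThetaHalf τ (2 * τ) = E⁻¹ * jacobiTheta₂ 0 (2 * τ) := by
    rw [zero_add] at h1
    rw [jacobiThetaHalf_eq, mul_div_cancel_left₀ τ two_ne_zero, ← two_mul, h1, ← mul_assoc,
      ← Complex.exp_add, hE, ← Complex.exp_neg]
    ring_nf
  have h4 : jacobiThetaHalf 0 τ ^ 2 = E * (jacobiTheta₂ (τ / 2) τ * jacobiTheta₂ (τ / 2) τ) := by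
    rw [jacobiThetaHalf_eq, mul_pow, zero_add, ← Complex.exp_nat_mul, hE]
    ring_nf
  have hE0 : E ≠ 0 := Complex.exp_ne_zero _
  rw [add_halves, sub_self] at h
  rw [h4, h, h3, h2]
  field_simp
  ring

/-- With a and b the two nulls at 2τ, this is (a² + b²)² = (2ab)² + (a² - b²)². -/
theorem jacobi_quartic {τ : ℂ} (hτ : 0 < τ.im) :
    jacobiTheta₂ 0 τ ^ 4 = jacobiThetaHalf 0 τ ^ 4 + jacobiTheta₂ (1 / 2) τ ^ 4 := by
  have h1 := jacobiTheta₂_zero_sq hτ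
  have h2 := jacobiTheta₂_half_sq hτ
  have h3 := jacobiThetaHalf_zero_sq hτ
  rw [show 4 = 2 * 2 by norm_num, pow_mul, pow_mul, pow_mul, h1, h2, h3]
  ring

/-- The arguments differ by a half, where the half-integer series vanishes, so only one of the two
products survives. -/
theorem jacobiTheta₂_mul_add_half (z : ℂ) {τ : ℂ} (hτ : 0 < τ.im) :
    jacobiTheta₂ z τ * jacobiTheta₂ (z + 1 / 2) τ =
      jacobiTheta₂ (2 * z + 1 / 2) (2 * τ) * jacobiTheta₂ (1 / 2) (2 * τ) := by
  rw [jacobiTheta₂_mul z (z + 1 / 2) hτ, show z - (z + 1 / 2) = -(1 / 2) by ring,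
    jacobiThetaHalf_neg, jacobiThetaHalf_half, jacobiTheta₂_neg_left, mul_zero, add_zero]
  ring_nf

end ComplexTheta

/-! ### Real theta functions and their extrema on the circle -/

/-- The theta function `∑ exp (-π t n²) cos (2 π n x)` of the circle of length one. -/
noncomputable def circleTheta (x t : ℝ) : ℝ := (jacobiTheta₂ x (t * Complex.I)).re

/-- The theta-null `∑ exp (-π t (n + 1/2)²)`. -/
noncomputable def halfTheta (t : ℝ) : ℝ := (jacobiThetaHalf 0 (t * Complex.I)).re

section RealTheta
open Complex Filter Topology
local notation "π" => Real.pi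

lemma ofReal_mul_I_im_pos {t : ℝ} (ht : 0 < t) : 0 < ((t : ℂ) * I).im := by simpa using ht

lemma coe_circleTheta (x t : ℝ) : (circleTheta x t : ℂ) = jacobiTheta₂ x (t * I) := by
  refine Complex.conj_eq_iff_re.mp ?_
  simp [jacobiTheta₂_conj]

lemma coe_halfTheta (t : ℝ) : (halfTheta t : ℂ) = jacobiThetaHalf 0 (t * I) := by
  refine Complex.conj_eq_iff_re.mp ?_
  rw [jacobiThetaHalf, Complex.conj_tsum]
  refine tsum_congr fun n => ?_
  rw [← Complex.exp_conj]
  simp [mul_assoc, mul_left_comm, Complex.conj_ofNat]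

lemma hasSum_circleTheta (x : ℝ) {t : ℝ} (ht : 0 < t) :
    HasSum (fun n : ℤ => Real.exp (-π * t * n ^ 2) * Real.cos (2 * π * n * x))
      (circleTheta x t) := by
  refine (Complex.hasSum_re (hasSum_jacobiTheta₂_term x (ofReal_mul_I_im_pos ht))).congr_fun
    fun n => ?_
  rw [jacobiTheta₂_term, show 2 * π * I * n * x + π * I * n ^ 2 * (t * I) =
    ((-π * t * n ^ 2 : ℝ) : ℂ) + ((2 * π * n * x : ℝ) : ℂ) * I by
      push_cast; linear_combination (π * n ^ 2 * t : ℂ) * I_mul_I]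
  rw [Complex.exp_re]
  simp only [add_re, ofReal_re, mul_re, I_re, mul_zero, ofReal_im, I_im, mul_one, sub_self,
    add_zero, add_im, mul_im, zero_add]

lemma hasSum_circleTheta_zero {t : ℝ} (ht : 0 < t) :
    HasSum (fun n : ℤ => Real.exp (-π * t * n ^ 2)) (circleTheta 0 t) := by
  simpa using hasSum_circleTheta 0 ht

lemma hasSum_halfTheta {t : ℝ} (ht : 0 < t) :
    HasSum (fun n : ℤ => Real.exp (-π * t * (n + 1 / 2) ^ 2)) (halfTheta t) := by
  refine (Complex.hasSum_re (hasSum_jacobiThetaHalf 0 (ofReal_mul_I_im_pos ht))).congr_fun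
    fun n => ?_
  rw [show 2 * π * I * (n + 1 / 2) * 0 + π * I * (n + 1 / 2) ^ 2 * (t * I) =
    ((-π * t * (n + 1 / 2) ^ 2 : ℝ) : ℂ) by
      push_cast; linear_combination (π * (n + 1 / 2) ^ 2 * t : ℂ) * I_mul_I]
  rw [Complex.exp_ofReal_re]

lemma halfTheta_pos {t : ℝ} (ht : 0 < t) : 0 < halfTheta t := by
  rw [← (hasSum_halfTheta ht).tsum_eq]
  exact (hasSum_halfTheta ht).summable.tsum_pos (fun _ => (Real.exp_pos _).le) 0 (Real.exp_pos _)

lemma circleTheta_le_zero (x : ℝ) {t : ℝ} (ht : 0 < t) : circleTheta x t ≤ circleTheta 0 t :=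
  hasSum_le (fun _ => mul_le_of_le_one_right (Real.exp_pos _).le (Real.cos_le_one _))
    (hasSum_circleTheta x ht) (hasSum_circleTheta_zero ht)

/-- Bound every cosine with n ≠ 0 below by -1. The bound is crude, but uniform in x and sharp as t →
∞. -/
lemma two_sub_circleTheta_zero_le (x : ℝ) {t : ℝ} (ht : 0 < t) :
    2 - circleTheta 0 t ≤ circleTheta x t := by
  refine hasSum_le (fun n => ?_) ((hasSum_ite_eq (0 : ℤ) (2 : ℝ)).sub (hasSum_circleTheta_zero ht))
    (hasSum_circleTheta x ht)
  by_cases hn : n = 0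
  · simp only [hn, if_true, Int.cast_zero]
    norm_num
  · simp only [hn, if_false]
    nlinarith [Real.exp_pos (-π * t * n ^ 2), Real.neg_one_le_cos (2 * π * n * x)]

lemma one_le_circleTheta_zero {t : ℝ} (ht : 0 < t) : 1 ≤ circleTheta 0 t := by
  linarith [two_sub_circleTheta_zero_le 0 ht]

lemma tendsto_circleTheta_zero : Tendsto (circleTheta 0) atTop (𝓝 1) := by
  have h1 : Tendsto (fun t : ℝ => Real.exp (-π * t)) atTop (𝓝 0) :=
    Real.tendsto_exp_atBot.comp (tendsto_id.const_mul_atTop_of_neg (by simpa using Real.pi_pos))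
  have h2 : Tendsto (fun t : ℝ => 1 + 2 / (1 - Real.exp (-π * t)) * Real.exp (-π * t)) atTop
      (𝓝 1) := by
    have h := ((tendsto_const_nhds (x := (2 : ℝ))).div (tendsto_const_nhds (x := (1 : ℝ)) |>.sub h1)
      (by norm_num)).mul h1
    simpa using h.const_add 1
  refine tendsto_of_tendsto_of_tendsto_of_le_of_le' tendsto_const_nhds h2 ?_ ?_
  · filter_upwards [eventually_gt_atTop 0] with t ht using one_le_circleTheta_zero ht
  · filter_upwards [eventually_gt_atTop 0] with t ht
    have h := norm_jacobiTheta_sub_one_le (ofReal_mul_I_im_pos ht)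
    have h' := coe_circleTheta 0 t
    rw [jacobiTheta_eq_jacobiTheta₂, ← Complex.ofReal_zero, ← h', ← Complex.ofReal_one,
      ← Complex.ofReal_sub, Complex.norm_real, Real.norm_eq_abs] at h
    simp only [mul_im, ofReal_re, I_im, mul_one, ofReal_im, I_re, mul_zero, add_zero] at h
    linarith [le_abs_self (circleTheta 0 t - 1)]

lemma continuousAt_circleTheta (x : ℝ) {t : ℝ} (ht : 0 < t) : ContinuousAt (circleTheta x) t := by
  have h := (differentiableAt_jacobiTheta₂_snd x (ofReal_mul_I_im_pos ht)).continuousAt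
  have h2 : ContinuousAt (fun t : ℝ => (t : ℂ) * I) t := by fun_prop
  exact Complex.continuous_re.continuousAt.comp (h.comp_of_eq h2 rfl)

lemma cpow_half_eq {t : ℝ} (ht : 0 < t) : (-I * (t * I)) ^ (1 / 2 : ℂ) = (√t : ℂ) := by
  rw [show -I * (t * I) = (t : ℂ) by linear_combination (-t : ℂ) * I_mul_I, Real.sqrt_eq_rpow,
    Complex.ofReal_cpow ht.le]
  norm_num

lemma neg_one_div_mul_I (t : ℝ) : -1 / ((t : ℂ) * I) = (t⁻¹ : ℝ) * I := by
  rw [Complex.ofReal_inv, ← div_div, Complex.div_I]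
  ring

theorem circleTheta_zero_inv {t : ℝ} (ht : 0 < t) :
    circleTheta 0 t⁻¹ = √t * circleTheta 0 t := by
  have h := jacobiTheta₂_functional_equation 0 (t * I)
  rw [neg_one_div_mul_I, cpow_half_eq ht, zero_div, ← Complex.ofReal_zero, ← coe_circleTheta,
    ← coe_circleTheta] at h
  have hs : (√t : ℂ) ≠ 0 := by exact_mod_cast (Real.sqrt_pos.mpr ht).ne'
  have : (circleTheta 0 t⁻¹ : ℂ) = √t * circleTheta 0 t := by
    rw [h]
    simp [hs]
  exact_mod_cast this

theorem halfTheta_inv {t : ℝ} (ht : 0 < t) :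
    halfTheta t⁻¹ = √t * circleTheta (1 / 2) t := by
  have h := jacobiTheta₂_functional_equation ((1 / 2 : ℝ) : ℂ) (t * I)
  have ht0 : (t : ℂ) ≠ 0 := by exact_mod_cast ht.ne'
  rw [neg_one_div_mul_I, cpow_half_eq ht, ← coe_circleTheta] at h
  have hs : (√t : ℂ) ≠ 0 := by exact_mod_cast (Real.sqrt_pos.mpr ht).ne'
  have : (halfTheta t⁻¹ : ℂ) = √t * circleTheta (1 / 2) t := by
    rw [h, coe_halfTheta, jacobiThetaHalf_eq, ← jacobiTheta₂_neg_left,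
      show ((1 / 2 : ℝ) : ℂ) / (t * I) = -(0 + (t⁻¹ : ℝ) * I / 2) by
        push_cast; field_simp; linear_combination I_sq,
      show -π * I * ((1 / 2 : ℝ) : ℂ) ^ 2 / (t * I) = π * I * 0 + π * I * ((t⁻¹ : ℝ) * I) / 4 by
        push_cast; field_simp; linear_combination -4 * I_sq]
    field_simp
  exact_mod_cast this

/-- The cosine series does not show the sign; the functional equation rewrites it as a Gaussian
factor times a sum of real exponentials. -/
theorem circleTheta_pos (x : ℝ) {t : ℝ} (ht : 0 < t) : 0 < circleTheta x t := by
  have h := jacobiTheta₂_functional_equation x (t * I)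
  have ht0 : (t : ℂ) ≠ 0 := by exact_mod_cast ht.ne'
  have hterm : ∀ n : ℤ, jacobiTheta₂_term n (x / (t * I)) ((t⁻¹ : ℝ) * I) =
      (Real.exp ((2 * π * n * x - π * n ^ 2) / t) : ℝ) := by
    intro n
    rw [jacobiTheta₂_term, Complex.ofReal_exp]
    congr 1
    push_cast
    field_simp
    linear_combination (n ^ 2 : ℂ) * I_sq
  have hsum := hasSum_jacobiTheta₂_term (x / (t * I)) (ofReal_mul_I_im_pos (inv_pos.mpr ht))
  simp_rw [hterm] at hsum
  have hre := Complex.hasSum_re hsum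
  simp only [Complex.ofReal_re] at hre
  have hcoe := (Complex.hasSum_ofReal.mpr hre).unique hsum
  have hpos : 0 < (jacobiTheta₂ (x / (t * I)) ((t⁻¹ : ℝ) * I)).re := by
    rw [← hre.tsum_eq]
    exact hre.summable.tsum_pos (fun _ => (Real.exp_pos _).le) 0 (Real.exp_pos _)
  rw [neg_one_div_mul_I, cpow_half_eq ht, ← coe_circleTheta, ← hcoe,
    show -π * I * (x : ℂ) ^ 2 / (t * I) = ((-π * x ^ 2 / t : ℝ) : ℂ) by push_cast; field_simp,
    ← Complex.ofReal_exp] at h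
  have h' : circleTheta x t = 1 / √t * Real.exp (-π * x ^ 2 / t) *
    (jacobiTheta₂ (x / (t * I)) ((t⁻¹ : ℝ) * I)).re := by exact_mod_cast h
  rw [h']
  have := Real.sqrt_pos.mpr ht
  positivity

lemma two_mul_mul_I (t : ℝ) : (2 : ℂ) * (t * I) = ((2 * t : ℝ) : ℂ) * I := by
  push_cast
  ring

theorem circleTheta_zero_sq {t : ℝ} (ht : 0 < t) :
    circleTheta 0 t ^ 2 = circleTheta 0 (2 * t) ^ 2 + halfTheta (2 * t) ^ 2 := by
  have h := jacobiTheta₂_zero_sq (ofReal_mul_I_im_pos ht)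
  rw [two_mul_mul_I, ← coe_halfTheta, ← Complex.ofReal_zero, ← coe_circleTheta,
    ← coe_circleTheta] at h
  exact_mod_cast h

theorem halfTheta_sq {t : ℝ} (ht : 0 < t) :
    halfTheta t ^ 2 = 2 * halfTheta (2 * t) * circleTheta 0 (2 * t) := by
  have h := jacobiThetaHalf_zero_sq (ofReal_mul_I_im_pos ht)
  rw [two_mul_mul_I, ← coe_halfTheta, ← coe_halfTheta, ← Complex.ofReal_zero,
    ← coe_circleTheta] at h
  exact_mod_cast h

theorem circleTheta_quartic {t : ℝ} (ht : 0 < t) :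
    circleTheta 0 t ^ 4 = halfTheta t ^ 4 + circleTheta (1 / 2) t ^ 4 := by
  have h := jacobi_quartic (ofReal_mul_I_im_pos ht)
  rw [← coe_halfTheta, ← Complex.ofReal_zero, ← coe_circleTheta,
    show (1 / 2 : ℂ) = ((1 / 2 : ℝ) : ℂ) by norm_num, ← coe_circleTheta] at h
  exact_mod_cast h

theorem circleTheta_mul_add_half (x : ℝ) {t : ℝ} (ht : 0 < t) :
    circleTheta x t * circleTheta (x + 1 / 2) t =
      circleTheta (2 * x + 1 / 2) (2 * t) * circleTheta (1 / 2) (2 * t) := by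
  have h := jacobiTheta₂_mul_add_half x (ofReal_mul_I_im_pos ht)
  rw [two_mul_mul_I, show (x + 1 / 2 : ℂ) = ((x + 1 / 2 : ℝ) : ℂ) by push_cast; rfl,
    show (2 * x + 1 / 2 : ℂ) = ((2 * x + 1 / 2 : ℝ) : ℂ) by push_cast; rfl,
    show (1 / 2 : ℂ) = ((1 / 2 : ℝ) : ℂ) by norm_num] at h
  simp only [← coe_circleTheta] at h
  exact_mod_cast h

/-- Divide the duplication identity at x by the one at 0, then use that θ(x + 1/2) is at most θ(0).
-/
lemma circleTheta_div_half_le (x : ℝ) {t : ℝ} (ht : 0 < t) :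
    circleTheta (2 * x + 1 / 2) (2 * t) / circleTheta (1 / 2) (2 * t) ≤
      circleTheta x t / circleTheta (1 / 2) t := by
  have ht2 : 0 < 2 * t := by positivity
  have h1 := circleTheta_mul_add_half x ht
  have h0 := circleTheta_mul_add_half 0 ht
  rw [mul_zero, zero_add] at h0
  have p1 := circleTheta_pos (1 / 2) ht
  have p2 := circleTheta_pos (1 / 2) ht2
  have p3 := circleTheta_pos x ht
  have h2 := circleTheta_le_zero (x + 1 / 2) ht
  rw [div_le_div_iff₀ p2 p1]
  refine le_of_mul_le_mul_right ?_ p2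
  calc circleTheta (2 * x + 1 / 2) (2 * t) * circleTheta (1 / 2) t * circleTheta (1 / 2) (2 * t)
      = circleTheta x t * (circleTheta (x + 1 / 2) t * circleTheta (1 / 2) t) := by
        linear_combination -circleTheta (1 / 2) t * h1
    _ ≤ circleTheta x t * (circleTheta 0 t * circleTheta (1 / 2) t) := by gcongr
    _ = circleTheta x t * circleTheta (1 / 2) (2 * t) * circleTheta (1 / 2) (2 * t) := by
        rw [h0]; ring

/-- The theta function of the circle is minimal at the antipode of the origin. -/
theorem circleTheta_half_le (x : ℝ) {t : ℝ} (ht : 0 < t) :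
    circleTheta (1 / 2) t ≤ circleTheta x t := by
  -- After n duplications the point x is out of control, so the bound at time 2ⁿ t must be uniform
  -- in x. The statement quantifies over x and t because the induction changes both.
  have key : ∀ (n : ℕ) (x t : ℝ), 0 < t →
      (2 - circleTheta 0 (2 ^ n * t)) / circleTheta 0 (2 ^ n * t) ≤
        circleTheta x t / circleTheta (1 / 2) t := by
    intro n
    induction n with
    | zero =>
      intro x t ht
      rw [pow_zero, one_mul]
      have p := circleTheta_pos (1 / 2) ht
      have p' := circleTheta_pos x ht
      calc (2 - circleTheta 0 t) / circleTheta 0 t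
          ≤ circleTheta x t / circleTheta 0 t := by
            have := circleTheta_pos 0 ht
            have := two_sub_circleTheta_zero_le x ht
            gcongr
        _ ≤ circleTheta x t / circleTheta (1 / 2) t := by
            have := circleTheta_le_zero (1 / 2) ht
            gcongr
    | succ n ih =>
      intro x t ht
      refine le_trans ?_ (circleTheta_div_half_le x ht)
      rw [pow_succ, mul_assoc]
      exact ih _ _ (by positivity)
  have hlim : Tendsto (fun n : ℕ => (2 - circleTheta 0 (2 ^ n * t)) / circleTheta 0 (2 ^ n * t))
      atTop (𝓝 1) := by
    have h := tendsto_circleTheta_zero.comp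
      ((tendsto_pow_atTop_atTop_of_one_lt (one_lt_two (α := ℝ))).atTop_mul_const ht)
    have h2 := (h.const_sub 2).div h one_ne_zero
    norm_num at h2
    exact h2
  have h := le_of_tendsto hlim (Eventually.of_forall fun n => key n x t ht)
  rwa [one_le_div (circleTheta_pos _ ht)] at h

theorem heatKernel_eq_mul (x y : ℝ) {α : ℝ} (hα : 0 < α) :
    heatKernel α x y 1 = circleTheta x (α ^ 2) * circleTheta y (α ^ 2)⁻¹ := by
  have h1 := hasSum_jacobiTheta₂_term x (ofReal_mul_I_im_pos (pow_pos hα 2))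
  have h2 := hasSum_jacobiTheta₂_term y (ofReal_mul_I_im_pos (inv_pos.mpr (pow_pos hα 2)))
  have h := hasSum_mul_prod h1 h2
  rw [← coe_circleTheta, ← coe_circleTheta] at h
  have : heatKernelC α x y 1 = ((circleTheta x (α ^ 2) * circleTheta y (α ^ 2)⁻¹ : ℝ) : ℂ) := by
    rw [heatKernelC, Complex.ofReal_mul, ← h.tsum_eq]
    refine tsum_congr fun m => ?_
    rw [jacobiTheta₂_term, jacobiTheta₂_term, ← Complex.exp_add, ← Complex.exp_add]
    congr 1
    push_cast
    linear_combination (-(π * m.1 ^ 2 * α ^ 2 + π * m.2 ^ 2 * ((α : ℂ) ^ 2)⁻¹) : ℂ) * I_sq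
  rw [heatKernel, this, Complex.ofReal_re]

lemma theta3_exp {t : ℝ} (ht : 0 < t) : theta3 (Real.exp (-π * t)) = circleTheta 0 t := by
  rw [theta3, ← (hasSum_circleTheta_zero ht).tsum_eq]
  exact tsum_congr fun n => by rw [← Real.exp_mul]

lemma theta2_exp {t : ℝ} (ht : 0 < t) : theta2 (Real.exp (-π * t)) = halfTheta t := by
  rw [theta2, ← (hasSum_halfTheta ht).tsum_eq]
  exact tsum_congr fun n => by rw [← Real.exp_mul]

end RealTheta

/-! ### Power series on the unit interval and monotone quotients -/

section PowerSeries
open Set Filter Topology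

/-- The real power series with coefficients `c` converges absolutely on `(-1, 1)`. -/
def ConvergesOnUnit (c : ℕ → ℝ) : Prop := ∀ r : ℝ, 0 ≤ r → r < 1 → Summable fun n => |c n| * r ^ n

/-- The sum of the real power series with coefficients `c`. -/
noncomputable def powerSum (c : ℕ → ℝ) (x : ℝ) : ℝ := ∑' n, c n * x ^ n

lemma ConvergesOnUnit.hasSum {c : ℕ → ℝ} (hc : ConvergesOnUnit c) {x : ℝ} (hx : |x| < 1) :
    HasSum (fun n => c n * x ^ n) (powerSum c x) := by
  refine Summable.hasSum (Summable.of_norm ?_)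
  simpa [abs_mul, abs_pow] using hc |x| (abs_nonneg x) hx

lemma ConvergesOnUnit.of_abs_le {c d : ℕ → ℝ} (hc : ConvergesOnUnit c) (h : ∀ n, |d n| ≤ |c n|) :
    ConvergesOnUnit d := fun r h0 h1 =>
  (hc r h0 h1).of_nonneg_of_le (fun n => by positivity)
    fun n => mul_le_mul_of_nonneg_right (h n) (by positivity)

lemma ConvergesOnUnit.nat_mul {c : ℕ → ℝ} (hc : ConvergesOnUnit c) :
    ConvergesOnUnit fun n => n * c n := by
  intro r h0 h1
  -- The gap between r and s absorbs the factor n, since n (r/s)ⁿ tends to 0.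
  obtain ⟨s, hrs, hs1⟩ := exists_between h1
  have hs0 : 0 < s := h0.trans_lt hrs
  have hlim : Tendsto (fun n : ℕ => (n : ℝ) * (r / s) ^ n) atTop (𝓝 0) :=
    tendsto_self_mul_const_pow_of_lt_one (by positivity) ((div_lt_one hs0).mpr hrs)
  refine summable_of_isBigO_nat (hc s hs0.le hs1) (Asymptotics.IsBigO.of_bound 1 ?_)
  filter_upwards [hlim.eventually_le_const zero_lt_one] with n hn
  rw [Real.norm_of_nonneg (by positivity), Real.norm_of_nonneg (by positivity), one_mul, abs_mul,
    Nat.abs_cast]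
  calc n * |c n| * r ^ n = (n * (r / s) ^ n) * (|c n| * s ^ n) := by
        rw [div_pow]; field_simp
    _ ≤ 1 * (|c n| * s ^ n) := by gcongr
    _ = _ := one_mul _

lemma ConvergesOnUnit.shift {c : ℕ → ℝ} (hc : ConvergesOnUnit c) :
    ConvergesOnUnit fun n => c (n + 1) := by
  intro r h0 h1
  obtain ⟨s, hrs, hs1⟩ := exists_between h1
  have hs0 : 0 < s := h0.trans_lt hrs
  refine (((summable_nat_add_iff 1).mpr (hc s hs0.le hs1)).mul_left s⁻¹).of_nonneg_of_le
    (fun n => by positivity) fun n => ?_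
  calc |c (n + 1)| * r ^ n ≤ |c (n + 1)| * s ^ n := by gcongr
    _ = _ := by rw [pow_succ]; field_simp

/-- The coefficients of the derivative of a power series. -/
def derivCoeff (c : ℕ → ℝ) (n : ℕ) : ℝ := (n + 1) * c (n + 1)

lemma ConvergesOnUnit.derivCoeff {c : ℕ → ℝ} (hc : ConvergesOnUnit c) :
    ConvergesOnUnit (derivCoeff c) := by
  have := hc.nat_mul.shift
  push_cast at this
  exact this

lemma ConvergesOnUnit.hasDerivAt {c : ℕ → ℝ} (hc : ConvergesOnUnit c) {x : ℝ} (hx : |x| < 1) :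
    HasDerivAt (powerSum c) (powerSum (RectTorus.derivCoeff c) x) x := by
  obtain ⟨s, hxs, hs1⟩ := exists_between hx
  have hs0 : 0 < s := (abs_nonneg x).trans_lt hxs
  have hu : Summable fun n : ℕ => |n * c n| * s ^ (n - 1) := by
    rw [← summable_nat_add_iff 1]
    simpa using hc.nat_mul.shift s hs0.le hs1
  have hmem : ∀ y : ℝ, y ∈ Ioo (-s) s ↔ |y| < s := fun y => abs_lt.symm
  have h := hasDerivAt_tsum_of_isPreconnected (g := fun n y => c n * y ^ n)
    (g' := fun n y => c n * (n * y ^ (n - 1))) (y₀ := 0) (y := x) hu isOpen_Ioo isPreconnected_Ioo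
    (fun n y _ => (hasDerivAt_pow n y).const_mul _) (fun n y hy => ?_)
    ((hmem 0).mpr (by simpa using hs0)) (hc.hasSum (by simp)).summable ((hmem x).mpr hxs)
  · have hsum : Summable fun n : ℕ => c n * (n * x ^ (n - 1)) := by
      refine hu.of_norm_bounded fun n => ?_
      rw [Real.norm_eq_abs, ← mul_assoc, mul_comm (c n), abs_mul, abs_pow]
      gcongr
    rw [hsum.tsum_eq_zero_add] at h
    simp only [Nat.cast_zero, zero_mul, mul_zero, zero_add] at h
    refine h.congr_deriv ?_
    simp only [RectTorus.derivCoeff, powerSum]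
    refine tsum_congr fun n => ?_
    push_cast
    ring
  · rw [Real.norm_eq_abs, ← mul_assoc, mul_comm (c n), abs_mul, abs_pow]
    have := ((hmem y).mp hy).le
    gcongr

/-- If the ratios `c n` of the coefficients of two power series with positive denominators are
strictly increasing, then so is the ratio of the sums on `(0, 1)`. -/
theorem strictMonoOn_powerSum_div {a c : ℕ → ℝ} (ha : ConvergesOnUnit a) (ha0 : ∀ n, 0 < a n)
    (hca : ConvergesOnUnit fun n => c n * a n) (hc : StrictMono c) :
    StrictMonoOn (fun x => powerSum (fun n => c n * a n) x / powerSum a x) (Ioo 0 1) := by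
  intro x hx y hy hxy
  have hx1 : |x| < 1 := by rw [abs_of_pos hx.1]; exact hx.2
  have hy1 : |y| < 1 := by rw [abs_of_pos hy.1]; exact hy.2
  have pos : ∀ z : ℝ, 0 < z → |z| < 1 → 0 < powerSum a z := fun z hz hz1 =>
    (ha.hasSum hz1).summable.tsum_pos (fun n => by have := ha0 n; positivity) 0
      (by have := ha0 0; positivity)
  have hmul : ∀ {f g : ℕ → ℝ} {u v : ℝ}, HasSum f u → HasSum g v →
      HasSum (fun p : ℕ × ℕ => f p.1 * g p.2) (u * v) := fun hf hg =>
    hf.mul hg (summable_mul_of_summable_norm hf.summable.norm hg.summable.norm)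
  have h1 := hmul (hca.hasSum hy1) (ha.hasSum hx1)
  have h2 := hmul (ha.hasSum hy1) (hca.hasSum hx1)
  have h3 := h1.sub h2
  -- Single terms of the double series have no useful sign. Adding the series with m and n swapped
  -- gives the terms a_m a_n (c_n - c_m) (yⁿ xᵐ - yᵐ xⁿ), which are nonnegative.
  have h4 := h3.add ((Equiv.prodComm ℕ ℕ).hasSum_iff.mpr h3)
  rw [div_lt_div_iff₀ (pos x hx.1 hx1) (pos y hy.1 hy1)]
  have hpow : ∀ {m n : ℕ}, m < n → y ^ m * x ^ n < y ^ n * x ^ m := by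
    intro m n hmn
    obtain ⟨k, rfl⟩ := Nat.exists_eq_add_of_lt hmn
    have hk : x ^ (k + 1) < y ^ (k + 1) := pow_lt_pow_left₀ hxy hx.1.le (by omega)
    have : 0 < y ^ m * x ^ m := mul_pos (pow_pos hy.1 _) (pow_pos hx.1 _)
    calc y ^ m * x ^ (m + k + 1) = y ^ m * x ^ m * x ^ (k + 1) := by ring
      _ < y ^ m * x ^ m * y ^ (k + 1) := mul_lt_mul_of_pos_left hk this
      _ = y ^ (m + k + 1) * x ^ m := by ring
  have hterm : ∀ m n : ℕ, m < n →
      0 < a m * a n * ((c n - c m) * (y ^ n * x ^ m - y ^ m * x ^ n)) := fun m n hmn =>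
    mul_pos (mul_pos (ha0 m) (ha0 n)) (mul_pos (sub_pos.mpr (hc hmn)) (sub_pos.mpr (hpow hmn)))
  have hpos : 0 < (powerSum (fun n => c n * a n) y * powerSum a x -
      powerSum a y * powerSum (fun n => c n * a n) x) +
      (powerSum (fun n => c n * a n) y * powerSum a x -
      powerSum a y * powerSum (fun n => c n * a n) x) := by
    rw [← h4.tsum_eq]
    refine h4.summable.tsum_pos ?_ (0, 1) ?_
    · rintro ⟨m, n⟩
      simp only [Function.comp_apply, Equiv.prodComm_apply, Prod.swap_prod_mk]
      rcases lt_trichotomy m n with h | h | h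
      · linarith [hterm m n h]
      · subst h
        apply le_of_eq
        ring
      · linarith [hterm n m h]
    · simp only [Function.comp_apply, Equiv.prodComm_apply, Prod.swap_prod_mk]
      linarith [hterm 0 1 one_pos]
  linarith

end PowerSeries

/-! ### The function F: differential equation, inequalities, Gauss's transformation -/

section Elliptic
open Set Filter Topology

lemma mul_powerSum_derivCoeff {c : ℕ → ℝ} (hc : ConvergesOnUnit c) {x : ℝ} (hx : |x| < 1) :
    x * powerSum (derivCoeff c) x = powerSum (fun n => n * c n) x := by
  have h := (hasSum_nat_add_iff' 1).mpr (hc.nat_mul.hasSum hx)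
  simp only [Finset.range_one, Finset.sum_singleton, Nat.cast_zero, zero_mul, sub_zero] at h
  refine (HasSum.unique ?_ h)
  refine ((hc.derivCoeff.hasSum hx).mul_left x).congr_fun fun n => ?_
  simp only [derivCoeff]
  push_cast
  ring

/-- The Taylor coefficients of `₂F₁(1/2, 1/2; 1; x)`. -/
noncomputable def ellipticCoeff (n : ℕ) : ℝ :=
  ((ascPochhammer ℝ n).eval (1 / 2) / n.factorial) ^ 2

lemma ellipticCoeff_zero : ellipticCoeff 0 = 1 := by simp [ellipticCoeff]

lemma ellipticCoeff_succ (n : ℕ) :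
    ellipticCoeff (n + 1) * (n + 1) ^ 2 = ellipticCoeff n * (n + 1 / 2) ^ 2 := by
  have : (n.factorial : ℝ) ≠ 0 := by positivity
  have : (n + 1 : ℝ) ≠ 0 := by positivity
  rw [ellipticCoeff, ellipticCoeff, ascPochhammer_succ_eval, Nat.factorial_succ]
  push_cast
  field_simp
  ring

lemma ellipticCoeff_pos (n : ℕ) : 0 < ellipticCoeff n := by
  have := ascPochhammer_pos n (1 / 2 : ℝ) (by norm_num)
  unfold ellipticCoeff
  positivity

lemma ellipticCoeff_le_one (n : ℕ) : ellipticCoeff n ≤ 1 := by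
  induction n with
  | zero => rw [ellipticCoeff_zero]
  | succ n ih =>
    have h := ellipticCoeff_succ n
    have hn : (0 : ℝ) ≤ n := n.cast_nonneg
    have h2 : ellipticCoeff (n + 1) * (n + 1) ^ 2 ≤ 1 * (n + 1 : ℝ) ^ 2 := by
      rw [h]
      gcongr
      norm_num
    exact le_of_mul_le_mul_right h2 (by positivity)

lemma convergesOnUnit_ellipticCoeff : ConvergesOnUnit ellipticCoeff := by
  refine ConvergesOnUnit.of_abs_le (c := fun _ => 1) (fun r h0 h1 => ?_) fun n => ?_
  · simpa using summable_geometric_of_lt_one h0 h1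
  · rw [abs_of_pos (ellipticCoeff_pos n), abs_one]
    exact ellipticCoeff_le_one n

/-- The function `₂F₁(1/2, 1/2; 1; x)`, i.e. `2 / π` times the complete elliptic integral of the
first kind of parameter `x`. -/
noncomputable def ellipticF : ℝ → ℝ := powerSum ellipticCoeff

/-- The derivative of `ellipticF`. -/
noncomputable def ellipticF' : ℝ → ℝ := powerSum (derivCoeff ellipticCoeff)

lemma hypergeometric_eq_ellipticF (x : ℝ) :
    ₂F₁ (1 / 2 : ℝ) (1 / 2 : ℝ) (1 : ℝ) x = ellipticF x := by
  rw [ordinaryHypergeometric_eq_tsum]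
  refine tsum_congr fun n => ?_
  rw [ascPochhammer_eval_one, smul_eq_mul, ellipticCoeff]
  field_simp

lemma hasDerivAt_ellipticF {x : ℝ} (hx : |x| < 1) : HasDerivAt ellipticF (ellipticF' x) x :=
  convergesOnUnit_ellipticCoeff.hasDerivAt hx

lemma ellipticF_zero : ellipticF 0 = 1 := by
  rw [← hypergeometric_eq_ellipticF, ordinaryHypergeometric_zero]

lemma abs_lt_one_of_mem {x : ℝ} (h0 : 0 ≤ x) (h1 : x < 1) : |x| < 1 := by
  rwa [abs_of_nonneg h0]

lemma ellipticF_pos {x : ℝ} (h0 : 0 ≤ x) (h1 : x < 1) : 0 < ellipticF x :=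
  (convergesOnUnit_ellipticCoeff.hasSum (abs_lt_one_of_mem h0 h1)).summable.tsum_pos
    (fun n => by have := ellipticCoeff_pos n; positivity) 0
    (by have := ellipticCoeff_pos 0; positivity)

/-- The quantity `x (1 - x) F'(x)`, where `F` is `ellipticF`. -/
noncomputable def ellipticP (x : ℝ) : ℝ := x * (1 - x) * ellipticF' x

/-- The hypergeometric differential equation of `ellipticF`. -/
theorem hasDerivAt_ellipticP {x : ℝ} (hx : |x| < 1) :
    HasDerivAt ellipticP (ellipticF x / 4) x := by
  have hc := convergesOnUnit_ellipticCoeff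
  have h1 := hc.nat_mul.hasDerivAt hx
  have hE := mul_powerSum_derivCoeff hc hx
  have hE' := mul_powerSum_derivCoeff hc.nat_mul hx
  have h2 := h1.mul ((hasDerivAt_id x).const_sub 1)
  have heq : ellipticP =ᶠ[𝓝 x] fun y => powerSum (fun n => n * ellipticCoeff n) y * (1 - id y) := by
    filter_upwards [(isOpen_lt continuous_abs continuous_const).mem_nhds hx] with y hy
    rw [← mul_powerSum_derivCoeff hc hy, ellipticP, ellipticF', id]
    ring
  refine (h2.congr_of_eventuallyEq heq).congr_deriv ?_
  have s0 := hc.nat_mul.hasSum hx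
  have s1 := hc.nat_mul.derivCoeff.hasSum hx
  have s2 := hc.nat_mul.nat_mul.hasSum hx
  have s3 := (s1.sub s2).sub s0
  have s4 := (hc.hasSum hx).div_const 4
  -- In coefficients this says (n + 1)² c_{n+1} - n² c_n - n c_n = c_n / 4, which is the recurrence,
  -- as (n + 1/2)² = n² + n + 1/4.
  have h5 := s3.unique (s4.congr_fun fun n => ?_)
  · rw [id, ellipticF, ← h5, ← hE']
    ring
  · have := ellipticCoeff_succ n
    simp only [derivCoeff]
    push_cast
    linear_combination x ^ n * this

/-- The power series of `F(x) / 2 - (1 - x) F'(x)`, where `F` is `ellipticF`. -/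
noncomputable def ellipticU : ℝ → ℝ :=
  powerSum fun n => (2 * n + 1) / (4 * (n + 1)) * ellipticCoeff n

lemma convergesOnUnit_ellipticU :
    ConvergesOnUnit fun n => (2 * n + 1) / (4 * (n + 1)) * ellipticCoeff n := by
  refine convergesOnUnit_ellipticCoeff.of_abs_le fun n => ?_
  rw [abs_mul, abs_of_nonneg (by positivity)]
  refine mul_le_of_le_one_left (abs_nonneg _) ?_
  rw [div_le_one (by positivity)]
  linarith [n.cast_nonneg (α := ℝ)]

/-- By the recurrence (1 - x) F' has coefficients c_n / (4 (n + 1)), decreasing multiples of c_n.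
Subtracting them from c_n / 2 yields increasing multiples, as the quotient lemma needs. -/
lemma one_sub_mul_ellipticF' {x : ℝ} (hx : |x| < 1) :
    (1 - x) * ellipticF' x = ellipticF x / 2 - ellipticU x := by
  have hc := convergesOnUnit_ellipticCoeff
  have h := mul_powerSum_derivCoeff hc hx
  have s1 := (hc.derivCoeff.hasSum hx).sub (hc.nat_mul.hasSum hx)
  have s2 := ((hc.hasSum hx).div_const 2).sub (convergesOnUnit_ellipticU.hasSum hx)
  have h2 := s1.unique (s2.congr_fun fun n => ?_)
  · rw [ellipticF', sub_mul, h, one_mul, h2]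
    rfl
  · have := ellipticCoeff_succ n
    simp only [derivCoeff]
    field_simp
    linear_combination 8 * x ^ n * this

lemma ellipticU_pos {x : ℝ} (h0 : 0 ≤ x) (h1 : x < 1) : 0 < ellipticU x :=
  (convergesOnUnit_ellipticU.hasSum (abs_lt_one_of_mem h0 h1)).summable.tsum_pos
    (fun n => by have := ellipticCoeff_pos n; positivity) 0
    (by have := ellipticCoeff_pos 0; positivity)

lemma strictMonoOn_ellipticF'_div :
    StrictMonoOn (fun x => ellipticF' x / ellipticF x) (Ioo 0 1) := by
  have hd : derivCoeff ellipticCoeff =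
      fun n : ℕ => ((n + 1 / 2) ^ 2 / (n + 1) : ℝ) * ellipticCoeff n := by
    ext n
    have := ellipticCoeff_succ n
    simp only [derivCoeff]
    field_simp
    linear_combination 4 * this
  have h := strictMonoOn_powerSum_div convergesOnUnit_ellipticCoeff ellipticCoeff_pos
    (hd ▸ convergesOnUnit_ellipticCoeff.derivCoeff) (strictMono_nat_of_lt_succ fun n => ?_)
  · rw [← hd] at h
    exact h
  · rw [div_lt_div_iff₀ (by positivity) (by positivity)]
    push_cast
    nlinarith [n.cast_nonneg (α := ℝ)]

lemma strictMonoOn_ellipticU_div :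
    StrictMonoOn (fun x => ellipticU x / ellipticF x) (Ioo 0 1) := by
  refine strictMonoOn_powerSum_div convergesOnUnit_ellipticCoeff ellipticCoeff_pos
    convergesOnUnit_ellipticU (strictMono_nat_of_lt_succ fun n => ?_)
  rw [div_lt_div_iff₀ (by positivity) (by positivity)]
  push_cast
  nlinarith [n.cast_nonneg (α := ℝ)]

lemma hasDerivAt_ellipticF_mul {x : ℝ} (h0 : 0 < x) (h1 : x < 1) :
    HasDerivAt (fun x => ellipticF x * ellipticF (1 - x))
      (ellipticF' x * ellipticF (1 - x) - ellipticF x * ellipticF' (1 - x)) x := by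
  have h := (hasDerivAt_ellipticF (abs_lt_one_of_mem h0.le h1)).mul
    ((hasDerivAt_ellipticF (abs_lt_one_of_mem (sub_nonneg.mpr h1.le)
      (sub_lt_self 1 h0))).comp x ((hasDerivAt_id x).const_sub 1))
  refine h.congr_deriv ?_
  simp only [Function.comp_apply]
  ring

lemma lt_of_strictAntiOn_of_symm {f : ℝ → ℝ} (hf : StrictAntiOn f (Ioc 0 (1 / 2)))
    (hsymm : ∀ x, f (1 - x) = f x) {x : ℝ} (h0 : 0 < x) (h1 : x < 1) (hx : x ≠ 1 / 2) :
    f (1 / 2) < f x := by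
  rcases hx.lt_or_gt with h | h
  · exact hf ⟨h0, h.le⟩ ⟨by norm_num, le_rfl⟩ h
  · rw [← hsymm x]
    exact hf ⟨by linarith, by linarith⟩ ⟨by norm_num, le_rfl⟩ (by linarith)

theorem ellipticF_mul_lt {x : ℝ} (h0 : 0 < x) (h1 : x < 1) (hx : x ≠ 1 / 2) :
    ellipticF (1 / 2) * ellipticF (1 - 1 / 2) < ellipticF x * ellipticF (1 - x) := by
  refine lt_of_strictAntiOn_of_symm (f := fun x => ellipticF x * ellipticF (1 - x)) ?_
    (fun x => by rw [sub_sub_cancel, mul_comm]) h0 h1 hx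
  refine strictAntiOn_of_deriv_neg (convex_Ioc _ _) (fun y hy =>
    (hasDerivAt_ellipticF_mul hy.1 (by linarith [hy.2])).continuousAt.continuousWithinAt) ?_
  intro y hy
  rw [interior_Ioc] at hy
  obtain ⟨hy0, hy2⟩ := hy
  have hy1 : y < 1 := by linarith
  rw [(hasDerivAt_ellipticF_mul hy0 hy1).deriv]
  have h := strictMonoOn_ellipticF'_div ⟨hy0, hy1⟩ ⟨by linarith, by linarith⟩
    (by linarith : y < 1 - y)
  have p1 := ellipticF_pos hy0.le hy1
  have p2 := ellipticF_pos (x := 1 - y) (by linarith) (by linarith)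
  simp only [div_lt_div_iff₀ p1 p2] at h
  linarith

/-- Eliminating F' through U cancels the derivative of x (1 - x) and leaves a comparison of x U/F at
x and at 1 - x. The function is negated so that the lemma on symmetric decreasing functions applies.
-/
theorem ellipticF_mul_sq_lt {x : ℝ} (h0 : 0 < x) (h1 : x < 1) (hx : x ≠ 1 / 2) :
    x * (1 - x) * (ellipticF x * ellipticF (1 - x)) ^ 2 <
      1 / 2 * (1 - 1 / 2) * (ellipticF (1 / 2) * ellipticF (1 - 1 / 2)) ^ 2 := by
  have hderiv : ∀ y : ℝ, 0 < y → y < 1 → HasDerivAt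
      (fun x => -(x * (1 - x) * (ellipticF x * ellipticF (1 - x)) ^ 2))
      (-(2 * (ellipticF y * ellipticF (1 - y)) *
        ((1 - y) * (ellipticU (1 - y) * ellipticF y) - y * (ellipticU y * ellipticF (1 - y))))) y := by
    intro y hy0 hy1
    have h := (((hasDerivAt_id y).mul ((hasDerivAt_id y).const_sub 1)).mul
      ((hasDerivAt_ellipticF_mul hy0 hy1).pow 2)).neg
    refine h.congr_deriv ?_
    have e1 := one_sub_mul_ellipticF' (abs_lt_one_of_mem hy0.le hy1)
    have e2 := one_sub_mul_ellipticF' (x := 1 - y) (abs_lt_one_of_mem (by linarith) (by linarith))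
    rw [sub_sub_cancel] at e2
    simp only [id, Pi.pow_apply, Pi.mul_apply]
    push_cast
    linear_combination (-2 * y * ellipticF y * ellipticF (1 - y) * ellipticF (1 - y)) * e1 +
      (2 * (1 - y) * ellipticF y * ellipticF (1 - y) * ellipticF y) * e2
  refine neg_lt_neg_iff.mp (lt_of_strictAntiOn_of_symm
    (f := fun x => -(x * (1 - x) * (ellipticF x * ellipticF (1 - x)) ^ 2)) ?_
    (fun x => by rw [sub_sub_cancel]; ring) h0 h1 hx)
  refine strictAntiOn_of_deriv_neg (convex_Ioc _ _) (fun y hy =>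
    (hderiv y hy.1 (by linarith [hy.2])).continuousAt.continuousWithinAt) ?_
  intro y hy
  rw [interior_Ioc] at hy
  obtain ⟨hy0, hy2⟩ := hy
  have hy1 : y < 1 := by linarith
  rw [(hderiv y hy0 hy1).deriv]
  have h := strictMonoOn_ellipticU_div ⟨hy0, hy1⟩ ⟨by linarith, by linarith⟩
    (by linarith : y < 1 - y)
  have p1 := ellipticF_pos hy0.le hy1
  have p2 := ellipticF_pos (x := 1 - y) (by linarith) (by linarith)
  have p3 := ellipticU_pos hy0.le hy1
  simp only [div_lt_div_iff₀ p1 p2] at h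
  have h3 : y * (ellipticU y * ellipticF (1 - y)) <
      (1 - y) * (ellipticU (1 - y) * ellipticF y) :=
    mul_lt_mul'' (by linarith) h hy0.le (by positivity)
  have := mul_pos (mul_pos two_pos (mul_pos p1 p2)) (sub_pos.mpr h3)
  linarith

/-- Gauss's quadratic transformation of the complete elliptic integral. -/
theorem ellipticF_gauss {y : ℝ} (h0 : 0 ≤ y) (h1 : y < 1) :
    ellipticF (4 * y / (1 + y) ^ 2) = (1 + y) * ellipticF (y ^ 2) := by
  -- Both K and G solve (p f')' = y f with p = y (1 - y²); S and Q are p K' and p G', written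
  -- through `ellipticP` so that no second derivative of F appears.
  set X : ℝ → ℝ := fun y => 4 * y / (1 + y) ^ 2 with hX
  set K : ℝ → ℝ := fun y => ellipticF (y ^ 2) with hK
  set G : ℝ → ℝ := fun y => ellipticF (X y) / (1 + y) with hG
  set S : ℝ → ℝ := fun y => 2 * ellipticP (y ^ 2) with hS
  set Q : ℝ → ℝ := fun y => (1 + y) * ellipticP (X y) - y * (1 - y) * G y with hQ
  have hX1 : ∀ y : ℝ, 0 ≤ y → y < 1 → |X y| < 1 := fun y h0 h1 => by
    refine abs_lt_one_of_mem (by positivity) ?_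
    rw [div_lt_one (by positivity)]
    nlinarith [mul_pos (sub_pos.mpr h1) (sub_pos.mpr h1)]
  have hsq1 : ∀ y : ℝ, 0 ≤ y → y < 1 → |y ^ 2| < 1 := fun y h0 h1 =>
    abs_lt_one_of_mem (by positivity) (by nlinarith)
  have dX : ∀ y : ℝ, 0 ≤ y → y < 1 → HasDerivAt X (4 * (1 - y) / (1 + y) ^ 3) y := by
    intro y h0 h1
    have := ((hasDerivAt_id y).const_mul 4).div (((hasDerivAt_id y).const_add 1).pow 2)
      (by simp only [id, Pi.pow_apply]; positivity)
    refine this.congr_deriv ?_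
    simp only [id, Pi.pow_apply]
    have : 1 + y ≠ 0 := by positivity
    field_simp
    ring
  have dsq : ∀ y : ℝ, HasDerivAt (fun y : ℝ => y ^ 2) (2 * y) y := fun y => by
    simpa using hasDerivAt_pow 2 y
  have dK : ∀ y : ℝ, 0 ≤ y → y < 1 → HasDerivAt K (ellipticF' (y ^ 2) * (2 * y)) y :=
    fun y h0 h1 => HasDerivAt.comp (h₂ := ellipticF) (h := fun y => y ^ 2) y
      (hasDerivAt_ellipticF (hsq1 y h0 h1)) (dsq y)
  have dS : ∀ y : ℝ, 0 ≤ y → y < 1 → HasDerivAt S (y * K y) y := fun y h0 h1 =>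
    ((HasDerivAt.comp (h₂ := ellipticP) (h := fun y => y ^ 2) y
      (hasDerivAt_ellipticP (hsq1 y h0 h1)) (dsq y)).const_mul 2).congr_deriv (by
        simp only [hK]; ring)
  have dG : ∀ y : ℝ, 0 ≤ y → y < 1 → HasDerivAt G
      ((ellipticF' (X y) * (4 * (1 - y) / (1 + y) ^ 3) - G y) / (1 + y)) y := by
    intro y h0 h1
    have hy : 1 + y ≠ 0 := by positivity
    refine (((hasDerivAt_ellipticF (hX1 y h0 h1)).comp y (dX y h0 h1)).div
      ((hasDerivAt_id y).const_add 1) hy).congr_deriv ?_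
    simp only [hG, Function.comp_apply, id]
    field_simp
  have eQ : ∀ y : ℝ, 0 ≤ y → y < 1 → Q y = y * (1 - y ^ 2) *
      ((ellipticF' (X y) * (4 * (1 - y) / (1 + y) ^ 3) - G y) / (1 + y)) := by
    intro y h0 h1
    have hy : 1 + y ≠ 0 := by positivity
    simp only [hQ, ellipticP]
    generalize ellipticF' (X y) = D
    simp only [hX]
    field_simp
    ring
  have eS : ∀ y : ℝ, S y = y * (1 - y ^ 2) * (ellipticF' (y ^ 2) * (2 * y)) := by
    intro y
    simp only [hS, ellipticP]
    ring
  have dQ : ∀ y : ℝ, 0 ≤ y → y < 1 → HasDerivAt Q (y * G y) y := by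
    intro y h0 h1
    have hy : 1 + y ≠ 0 := by positivity
    have d1 := ((hasDerivAt_id y).const_add 1).mul
      ((hasDerivAt_ellipticP (hX1 y h0 h1)).comp y (dX y h0 h1))
    have d2 := ((hasDerivAt_id y).mul ((hasDerivAt_id y).const_sub 1)).mul (dG y h0 h1)
    refine (d1.sub d2).congr_deriv ?_
    have hF : ellipticF (X y) = (1 + y) * G y := by simp only [hG]; field_simp
    simp only [Function.comp_apply, id, Pi.mul_apply, hF, ellipticP]
    generalize ellipticF' (X y) = D
    generalize G y = g
    simp only [hX]
    field_simp
    ring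
  -- This is p times the Wronskian of G and K: it is constant by the common equation, and zero at
  -- the singular point 0.
  have hwron : ∀ y : ℝ, 0 < y → y < 1 → G y * S y - K y * Q y = 0 := by
    intro z hz0 hz1
    have hcont : ContinuousOn (fun y => G y * S y - K y * Q y) (Icc 0 z) := by
      intro y hy
      have hy1 := hy.2.trans_lt hz1
      exact ((((dG y hy.1 hy1).mul (dS y hy.1 hy1)).sub ((dK y hy.1 hy1).mul
        (dQ y hy.1 hy1))).continuousAt).continuousWithinAt
    have hder : ∀ y ∈ Ioo 0 z, HasDerivAt (fun y => G y * S y - K y * Q y) 0 y := by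
      intro y hy
      have hy1 := hy.2.trans hz1
      refine (((dG y hy.1.le hy1).mul (dS y hy.1.le hy1)).sub ((dK y hy.1.le hy1).mul
        (dQ y hy.1.le hy1))).congr_deriv ?_
      rw [eQ y hy.1.le hy1, eS y]
      ring
    obtain ⟨c, hc, hc2⟩ := exists_hasDerivAt_eq_slope (fun y => G y * S y - K y * Q y)
      (fun _ => 0) hz0 hcont hder
    have hS0 : S 0 = 0 := by simp [hS, ellipticP]
    have hQ0 : Q 0 = 0 := by simp [hQ, hX, ellipticP]
    rw [hS0, hQ0, mul_zero, mul_zero, sub_zero, sub_zero, sub_zero, eq_comm,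
      div_eq_zero_iff] at hc2
    exact hc2.resolve_right hz0.ne'
  have hK0 : ∀ y : ℝ, 0 ≤ y → y < 1 → K y ≠ 0 := fun y h0 h1 =>
    (ellipticF_pos (by positivity) (by nlinarith)).ne'
  -- A vanishing Wronskian makes G/K constant, and its value at 0 is 1.
  have hGK : G y = K y := by
    rcases h0.eq_or_lt with rfl | hy0
    · simp [hG, hK, hX]
    have hcont : ContinuousOn (fun y => G y / K y) (Icc 0 y) := by
      intro z hz
      have hz1 := hz.2.trans_lt h1
      exact ((dG z hz.1 hz1).div (dK z hz.1 hz1) (hK0 z hz.1 hz1)).continuousAt.continuousWithinAt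
    have hder : ∀ z ∈ Ioo 0 y, HasDerivAt (fun y => G y / K y) 0 z := by
      intro z hz
      have hz1 := hz.2.trans h1
      refine ((dG z hz.1.le hz1).div (dK z hz.1.le hz1) (hK0 z hz.1.le hz1)).congr_deriv ?_
      have hw := hwron z hz.1 hz1
      rw [eQ z hz.1.le hz1, eS z] at hw
      have hz2 : z * (1 - z ^ 2) ≠ 0 := mul_ne_zero hz.1.ne' (by nlinarith [hz.1])
      rw [div_eq_zero_iff]
      left
      refine (mul_eq_zero.mp (?_ : z * (1 - z ^ 2) * _ = 0)).resolve_left hz2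
      linear_combination -hw
    obtain ⟨c, hc, hc2⟩ := exists_hasDerivAt_eq_slope (fun y => G y / K y)
      (fun _ => 0) hy0 hcont hder
    have hG0 : G 0 / K 0 = 1 := by simp [hG, hK, hX, ellipticF_zero]
    rw [hG0, eq_comm, div_eq_zero_iff] at hc2
    have := hc2.resolve_right (by linarith)
    exact (div_eq_one_iff_eq (hK0 y h0 h1)).mp (sub_eq_zero.mp this)
  have hy : 1 + y ≠ 0 := by positivity
  have : ellipticF (X y) = (1 + y) * G y := by simp only [hG]; field_simp
  rw [hGK] at this
  exact this

end Elliptic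

/-! ### Jacobi's formula, the modulus as a parameter, and the extremal temperatures -/

section Main
open Set Filter Topology
local notation "π" => Real.pi

lemma modulus_exp {t : ℝ} (ht : 0 < t) :
    modulus (Real.exp (-π * t)) = halfTheta t ^ 2 / circleTheta 0 t ^ 2 := by
  rw [modulus, theta2_exp ht, theta3_exp ht]

lemma modulus_exp_pos {t : ℝ} (ht : 0 < t) : 0 < modulus (Real.exp (-π * t)) := by
  have := halfTheta_pos ht
  have := circleTheta_pos 0 ht
  rw [modulus_exp ht]
  positivity

lemma modulus_exp_sq {t : ℝ} (ht : 0 < t) :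
    1 - modulus (Real.exp (-π * t)) ^ 2 = (circleTheta (1 / 2) t ^ 2 / circleTheta 0 t ^ 2) ^ 2 := by
  have := (circleTheta_pos 0 ht).ne'
  rw [modulus_exp ht]
  field_simp
  linear_combination circleTheta_quartic ht

lemma compModulus_exp {t : ℝ} (ht : 0 < t) :
    compModulus (Real.exp (-π * t)) = circleTheta (1 / 2) t ^ 2 / circleTheta 0 t ^ 2 := by
  rw [compModulus, modulus_exp_sq ht, Real.sqrt_sq (by positivity)]

lemma compModulus_exp_pos {t : ℝ} (ht : 0 < t) : 0 < compModulus (Real.exp (-π * t)) := by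
  have := circleTheta_pos (1 / 2) ht
  have := circleTheta_pos 0 ht
  rw [compModulus_exp ht]
  positivity

lemma compModulus_exp_sq {t : ℝ} (ht : 0 < t) :
    compModulus (Real.exp (-π * t)) ^ 2 = 1 - modulus (Real.exp (-π * t)) ^ 2 := by
  rw [modulus_exp_sq ht, compModulus_exp ht]

lemma modulus_exp_lt_one {t : ℝ} (ht : 0 < t) : modulus (Real.exp (-π * t)) < 1 := by
  have h1 := compModulus_exp_sq ht
  have h2 := compModulus_exp_pos ht
  have h3 := modulus_exp_pos ht
  nlinarith

lemma compModulus_exp_lt_one {t : ℝ} (ht : 0 < t) : compModulus (Real.exp (-π * t)) < 1 := by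
  have h1 := compModulus_exp_sq ht
  have h2 := compModulus_exp_pos ht
  have h3 := modulus_exp_pos ht
  nlinarith

/-- Inversion turns θ₂ into √t θ₄ and θ₃ into √t θ₃; the factors √t cancel in the quotient. -/
lemma modulus_exp_inv {t : ℝ} (ht : 0 < t) :
    modulus (Real.exp (-π * t⁻¹)) = compModulus (Real.exp (-π * t)) := by
  have := (circleTheta_pos 0 ht).ne'
  have := (Real.sqrt_pos.mpr ht).ne'
  rw [modulus_exp (inv_pos.mpr ht), compModulus_exp ht, halfTheta_inv ht, circleTheta_zero_inv ht]
  field_simp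

lemma compModulus_exp_inv {t : ℝ} (ht : 0 < t) :
    compModulus (Real.exp (-π * t⁻¹)) = modulus (Real.exp (-π * t)) := by
  rw [← modulus_exp_inv (inv_pos.mpr ht), inv_inv]

lemma tendsto_modulus_exp : Tendsto (fun t => modulus (Real.exp (-π * t))) atTop (𝓝 0) := by
  have h := tendsto_circleTheta_zero
  have h2 : Tendsto (fun t => (2 - circleTheta 0 t) / circleTheta 0 t) atTop (𝓝 1) := by
    have := (h.const_sub 2).div h one_ne_zero
    norm_num at this
    exact this
  have hc : Tendsto (fun t => circleTheta (1 / 2) t / circleTheta 0 t) atTop (𝓝 1) := by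
    refine tendsto_of_tendsto_of_tendsto_of_le_of_le' h2 tendsto_const_nhds ?_ ?_
    · filter_upwards [eventually_gt_atTop 0] with t ht
      have := circleTheta_pos 0 ht
      have := two_sub_circleTheta_zero_le (1 / 2) ht
      gcongr
    · filter_upwards [eventually_gt_atTop 0] with t ht
      rw [div_le_one (circleTheta_pos 0 ht)]
      exact circleTheta_le_zero _ ht
  -- By the quartic identity this square root is the modulus itself for t > 0.
  have h3 : Tendsto (fun t => √(1 - (circleTheta (1 / 2) t / circleTheta 0 t) ^ 4)) atTop
      (𝓝 0) := by
    have := ((hc.pow 4).const_sub 1).sqrt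
    norm_num at this
    exact this
  refine h3.congr' ?_
  filter_upwards [eventually_gt_atTop 0] with t ht
  rw [← Real.sqrt_sq (modulus_exp_pos ht).le, ← sub_sub_cancel 1 (modulus _ ^ 2),
    modulus_exp_sq ht]
  congr 2
  rw [← div_pow, ← pow_mul]

/-- Jacobi's formula for the complete elliptic integral. -/
theorem ellipticF_modulus_sq {t : ℝ} (ht : 0 < t) :
    ellipticF (modulus (Real.exp (-π * t)) ^ 2) = circleTheta 0 t ^ 2 := by
  -- If y is the modulus at 2t, duplication gives k² = 4y/(1 + y)² at t, while θ₃² gains the factor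
  -- 1 + y. Gauss's transformation gives F the same factor.
  have step : ∀ t : ℝ, 0 < t →
      ellipticF (modulus (Real.exp (-π * t)) ^ 2) / circleTheta 0 t ^ 2 =
        ellipticF (modulus (Real.exp (-π * (2 * t))) ^ 2) / circleTheta 0 (2 * t) ^ 2 := by
    intro t ht
    have ht2 : 0 < 2 * t := by positivity
    have p1 := circleTheta_pos 0 ht
    have p2 := circleTheta_pos 0 ht2
    have p3 := halfTheta_pos ht2
    have e1 := circleTheta_zero_sq ht
    have hsq : modulus (Real.exp (-π * t)) ^ 2 = 4 * modulus (Real.exp (-π * (2 * t))) /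
        (1 + modulus (Real.exp (-π * (2 * t)))) ^ 2 := by
      rw [modulus_exp ht, modulus_exp ht2, halfTheta_sq ht, e1]
      field_simp
      ring
    rw [hsq, ellipticF_gauss (modulus_exp_pos ht2).le (modulus_exp_lt_one ht2), e1]
    generalize ellipticF _ = f
    rw [modulus_exp ht2]
    field_simp
  have iter : ∀ n : ℕ, ellipticF (modulus (Real.exp (-π * t)) ^ 2) / circleTheta 0 t ^ 2 =
      ellipticF (modulus (Real.exp (-π * (2 ^ n * t))) ^ 2) / circleTheta 0 (2 ^ n * t) ^ 2 := by
    intro n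
    induction n with
    | zero => rw [pow_zero, one_mul]
    | succ n ih =>
      rw [ih, step _ (by positivity), show 2 * (2 ^ n * t) = 2 ^ (n + 1) * t by ring]
  have hlim : Tendsto (fun t => ellipticF (modulus (Real.exp (-π * t)) ^ 2) / circleTheta 0 t ^ 2)
      atTop (𝓝 1) := by
    have hF : Tendsto ellipticF (𝓝 0) (𝓝 1) := by
      have := (hasDerivAt_ellipticF (x := 0) (by simp)).continuousAt.tendsto
      rwa [ellipticF_zero] at this
    have h1 := tendsto_modulus_exp.pow 2
    rw [zero_pow two_ne_zero] at h1
    have h2 := (hF.comp h1).div (tendsto_circleTheta_zero.pow 2) (by norm_num)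
    rw [one_pow, div_one] at h2
    exact h2
  have h := hlim.comp
    ((tendsto_pow_atTop_atTop_of_one_lt (one_lt_two (α := ℝ))).atTop_mul_const ht)
  have h1 := tendsto_nhds_unique (tendsto_const_nhds.congr iter) h
  exact (div_eq_one_iff_eq (pow_pos (circleTheta_pos 0 ht) 2).ne').mp h1

lemma ellipticF_compModulus_sq {t : ℝ} (ht : 0 < t) :
    ellipticF (compModulus (Real.exp (-π * t)) ^ 2) = circleTheta 0 t⁻¹ ^ 2 := by
  rw [← modulus_exp_inv ht, ellipticF_modulus_sq (inv_pos.mpr ht)]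

lemma B_eq {k' : ℝ} (hk : k' ∈ Ioo (0 : ℝ) 1) :
    B k' = √(ellipticF (k' ^ 2) * ellipticF (1 - k' ^ 2)) := by
  rw [B, hypergeometric_eq_ellipticF, hypergeometric_eq_ellipticF,
    Real.sq_sqrt (by nlinarith [hk.1, hk.2]), mul_comm]

/-- Passing to a fourth root removes the inner square root k and leaves a function of k'² alone. -/
lemma A_eq {k' : ℝ} (hk : k' ∈ Ioo (0 : ℝ) 1) :
    A k' = √√(k' ^ 2 * (1 - k' ^ 2) * (ellipticF (k' ^ 2) * ellipticF (1 - k' ^ 2)) ^ 2) := by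
  have h1 : 0 < 1 - k' ^ 2 := by nlinarith [hk.1, hk.2]
  have h2 : 0 < k' ^ 2 := pow_pos hk.1 2
  have p1 := ellipticF_pos h2.le (by linarith : k' ^ 2 < 1)
  have p2 := ellipticF_pos h1.le (by linarith : 1 - k' ^ 2 < 1)
  rw [A, hypergeometric_eq_ellipticF, hypergeometric_eq_ellipticF, Real.sq_sqrt h1.le,
    Real.sqrt_mul (x := k' ^ 2 * (1 - k' ^ 2)) (by positivity),
    Real.sqrt_sq (x := ellipticF _ * _) (by positivity), Real.sqrt_mul h2.le, Real.sqrt_sq hk.1.le]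
  congr 1
  ring

/-- Here k' is θ₄²/θ₃² at t and k is θ₄²/θ₃² at 1/t, so Jacobi's formula cancels every θ₃. -/
lemma A_compModulus {t : ℝ} (ht : 0 < t) :
    A (compModulus (Real.exp (-π * t))) = circleTheta (1 / 2) t * circleTheta (1 / 2) t⁻¹ := by
  have p := circleTheta_pos (1 / 2) ht
  have p' := circleTheta_pos (1 / 2) (inv_pos.mpr ht)
  have r := circleTheta_pos 0 ht
  have r' := circleTheta_pos 0 (inv_pos.mpr ht)
  rw [A, hypergeometric_eq_ellipticF, hypergeometric_eq_ellipticF, compModulus_exp_sq ht,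
    sub_sub_cancel, Real.sqrt_sq (modulus_exp_pos ht).le, ← compModulus_exp_sq ht,
    ellipticF_modulus_sq ht, ellipticF_compModulus_sq ht, compModulus_exp ht,
    ← compModulus_exp_inv ht, compModulus_exp (inv_pos.mpr ht),
    ← Real.sqrt_sq (mul_pos p p').le]
  congr 1
  generalize circleTheta 0 t⁻¹ = a at *
  generalize circleTheta (1 / 2) t⁻¹ = b at *
  field_simp

lemma B_compModulus {t : ℝ} (ht : 0 < t) :
    B (compModulus (Real.exp (-π * t))) = circleTheta 0 t * circleTheta 0 t⁻¹ := by
  have r := circleTheta_pos 0 ht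
  have r' := circleTheta_pos 0 (inv_pos.mpr ht)
  rw [B, hypergeometric_eq_ellipticF, hypergeometric_eq_ellipticF, compModulus_exp_sq ht,
    sub_sub_cancel, Real.sqrt_sq (modulus_exp_pos ht).le, ← compModulus_exp_sq ht,
    ellipticF_modulus_sq ht, ellipticF_compModulus_sq ht, ← mul_pow,
    Real.sqrt_sq (mul_pos r r').le]

lemma one_div_sqrt_two_mem : 1 / √2 ∈ Ioo (0 : ℝ) 1 :=
  ⟨by positivity, (div_lt_one (by positivity)).mpr (Real.lt_sqrt_of_sq_lt (by norm_num))⟩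

lemma one_div_sqrt_two_sq : (1 / √2) ^ 2 = (1 / 2 : ℝ) := by
  rw [div_pow, Real.sq_sqrt zero_le_two, one_pow]

lemma eq_one_div_sqrt_two {k : ℝ} (h0 : 0 < k) (h : k ^ 2 = 1 / 2) : k = 1 / √2 :=
  (pow_left_inj₀ h0.le one_div_sqrt_two_mem.1.le two_ne_zero).mp (h.trans one_div_sqrt_two_sq.symm)

lemma one_div_sqrt_two_eq_sqrt : 1 / √2 = √(1 - (1 / √2) ^ 2) := by
  rw [one_div_sqrt_two_sq, show (1 : ℝ) - 1 / 2 = (1 / √2) ^ 2 by rw [one_div_sqrt_two_sq]; norm_num,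
    Real.sqrt_sq one_div_sqrt_two_mem.1.le]

theorem A_lt {k' : ℝ} (hk : k' ∈ Ioo (0 : ℝ) 1) (hne : k' ≠ 1 / √2) : A k' < A (1 / √2) := by
  have h0 : 0 < k' ^ 2 := pow_pos hk.1 2
  have h1 : k' ^ 2 < 1 := by nlinarith [hk.1, hk.2]
  have h := ellipticF_mul_sq_lt h0 h1 fun h => hne (eq_one_div_sqrt_two hk.1 h)
  rw [A_eq hk, A_eq one_div_sqrt_two_mem, one_div_sqrt_two_sq]
  have hn : 0 ≤ k' ^ 2 * (1 - k' ^ 2) * (ellipticF (k' ^ 2) * ellipticF (1 - k' ^ 2)) ^ 2 :=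
    mul_nonneg (mul_nonneg h0.le (by linarith)) (sq_nonneg _)
  exact Real.sqrt_lt_sqrt (Real.sqrt_nonneg _) (Real.sqrt_lt_sqrt hn h)

theorem lt_B {k' : ℝ} (hk : k' ∈ Ioo (0 : ℝ) 1) (hne : k' ≠ 1 / √2) : B (1 / √2) < B k' := by
  have h0 : 0 < k' ^ 2 := pow_pos hk.1 2
  have h1 : k' ^ 2 < 1 := by nlinarith [hk.1, hk.2]
  have h := ellipticF_mul_lt h0 h1 fun h => hne (eq_one_div_sqrt_two hk.1 h)
  rw [B_eq hk, B_eq one_div_sqrt_two_mem, one_div_sqrt_two_sq]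
  exact Real.sqrt_lt_sqrt (mul_pos (ellipticF_pos (by norm_num) (by norm_num))
    (ellipticF_pos (by norm_num) (by norm_num))).le h

lemma compModulus_exp_neg_pi : compModulus (Real.exp (-π)) = 1 / √2 := by
  have h := compModulus_exp_sq one_pos
  have h2 := modulus_exp_inv one_pos
  rw [inv_one] at h2
  rw [h2, mul_one] at h
  refine eq_one_div_sqrt_two ?_ (by linarith)
  simpa using compModulus_exp_pos one_pos

theorem injOn_compModulus_exp : InjOn (fun t => compModulus (Real.exp (-π * t))) (Ioi 0) := by
  -- The quotient is θ₃(1/t)²/θ₃(t)² = t, so t can be read off from k'.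
  have key : ∀ t : ℝ, 0 < t → t = ellipticF (compModulus (Real.exp (-π * t)) ^ 2) /
      ellipticF (1 - compModulus (Real.exp (-π * t)) ^ 2) := by
    intro t ht
    rw [ellipticF_compModulus_sq ht, compModulus_exp_sq ht, sub_sub_cancel,
      ellipticF_modulus_sq ht, circleTheta_zero_inv ht, mul_pow, Real.sq_sqrt ht.le,
      mul_div_cancel_right₀ _ (pow_pos (circleTheta_pos 0 ht) 2).ne']
  intro s hs t ht hst
  simp only at hst
  rw [key s hs, key t ht, hst]

/-- Intermediate value theorem. The single limit k → 0 at infinity serves both ends: directly it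
brings k' close to 1, and through t ↦ 1/t close to 0. -/
theorem surjOn_compModulus_exp :
    SurjOn (fun t => compModulus (Real.exp (-π * t))) (Ioi 0) (Ioo 0 1) := by
  intro k hk
  have hcont : ContinuousOn (fun t => compModulus (Real.exp (-π * t))) (Ioi 0) := by
    have : ContinuousOn (fun t => circleTheta (1 / 2) t ^ 2 / circleTheta 0 t ^ 2) (Ioi 0) :=
      fun t ht => (((continuousAt_circleTheta _ ht).pow 2).div ((continuousAt_circleTheta _ ht).pow 2)
        (pow_pos (circleTheta_pos 0 ht) 2).ne').continuousWithinAt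
    exact this.congr fun t ht => compModulus_exp ht
  have hbelow : ∀ ε : ℝ, 0 < ε → ∃ t : ℝ, 0 < t ∧ modulus (Real.exp (-π * t)) < ε := fun ε hε =>
    ((eventually_gt_atTop 0).and (tendsto_modulus_exp.eventually_lt_const hε)).exists
  obtain ⟨s, hs, hsk⟩ := hbelow k hk.1
  obtain ⟨t, ht, htk⟩ := hbelow (√(1 - k ^ 2))
    (Real.sqrt_pos.mpr (by nlinarith [hk.1, hk.2]))
  have hlow : compModulus (Real.exp (-π * s⁻¹)) ≤ k := by rw [compModulus_exp_inv hs]; exact hsk.le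
  have hhigh : k ≤ compModulus (Real.exp (-π * t)) := by
    have h1 := (Real.lt_sqrt (modulus_exp_pos ht).le).mp htk
    have h2 := compModulus_exp_sq ht
    exact (pow_le_pow_iff_left₀ hk.1.le (compModulus_exp_pos ht).le two_ne_zero).mp (by linarith)
  exact isPreconnected_Ioi.intermediate_value (mem_Ioi.mpr (inv_pos.mpr hs)) (mem_Ioi.mpr ht) hcont
    ⟨hlow, hhigh⟩

theorem bijOn_compModulus :
    BijOn (fun α : ℝ => compModulus (Real.exp (-π * α ^ 2))) (Ioi 0) (Ioo 0 1) := by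
  refine ⟨fun α hα => ?_, fun α hα β hβ h => ?_, fun k hk => ?_⟩
  · have hα2 : 0 < α ^ 2 := pow_pos hα 2
    exact ⟨compModulus_exp_pos hα2, compModulus_exp_lt_one hα2⟩
  · exact (pow_left_inj₀ (le_of_lt hα) (le_of_lt hβ) two_ne_zero).mp
      (injOn_compModulus_exp (mem_Ioi.mpr (pow_pos hα 2)) (mem_Ioi.mpr (pow_pos hβ 2)) h)
  · obtain ⟨t, ht, rfl⟩ := surjOn_compModulus_exp hk
    exact ⟨√t, Real.sqrt_pos.mpr ht, by simp only [Real.sq_sqrt (le_of_lt ht)]⟩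

theorem isLeast_temperatures {α : ℝ} (hα : 0 < α) :
    IsLeast (temperatures α 1) (A (compModulus (Real.exp (-π * α ^ 2)))) := by
  have hα2 := pow_pos hα 2
  rw [A_compModulus hα2]
  refine ⟨⟨(1 / 2, 1 / 2), heatKernel_eq_mul _ _ hα⟩, ?_⟩
  rintro _ ⟨⟨x, y⟩, rfl⟩
  simp only [heatKernel_eq_mul _ _ hα]
  exact mul_le_mul (circleTheta_half_le _ hα2) (circleTheta_half_le _ (inv_pos.mpr hα2))
    (circleTheta_pos _ (inv_pos.mpr hα2)).le (circleTheta_pos _ hα2).le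

theorem isGreatest_temperatures {α : ℝ} (hα : 0 < α) :
    IsGreatest (temperatures α 1) (B (compModulus (Real.exp (-π * α ^ 2)))) := by
  have hα2 := pow_pos hα 2
  rw [B_compModulus hα2]
  refine ⟨⟨(0, 0), heatKernel_eq_mul _ _ hα⟩, ?_⟩
  rintro _ ⟨⟨x, y⟩, rfl⟩
  simp only [heatKernel_eq_mul _ _ hα]
  exact mul_le_mul (circleTheta_le_zero _ hα2) (circleTheta_le_zero _ (inv_pos.mpr hα2))
    (circleTheta_pos _ (inv_pos.mpr hα2)).le (circleTheta_pos _ hα2).le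

lemma minTemp_eq {α : ℝ} (hα : 0 < α) :
    minTemp α 1 = A (compModulus (Real.exp (-π * α ^ 2))) :=
  (isLeast_temperatures hα).csInf_eq

lemma maxTemp_eq {α : ℝ} (hα : 0 < α) :
    maxTemp α 1 = B (compModulus (Real.exp (-π * α ^ 2))) :=
  (isGreatest_temperatures hα).csSup_eq

end Main

end RectTorus

theorem mainTheorem4 :
    -- the inequalities as functions of the complementary modulus, with the equality cases
    (∀ k' ∈ Set.Ioo (0 : ℝ) 1,
      RectTorus.A k' ≤ RectTorus.A (1 / √2) ∧
      RectTorus.B k' ≥ RectTorus.B (1 / √2) ∧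
      (RectTorus.A k' = RectTorus.A (1 / √2) ↔ k' = √(1 - k' ^ 2) ∧ k' = 1 / √2) ∧
      (RectTorus.B k' = RectTorus.B (1 / √2) ↔ k' = √(1 - k' ^ 2) ∧ k' = 1 / √2)) ∧
    -- the complementary modulus parametrizes the rectangular tori of area one
    Set.BijOn (fun α : ℝ => RectTorus.compModulus (Real.exp (-Real.pi * α ^ 2)))
      (Set.Ioi 0) (Set.Ioo 0 1) ∧
    RectTorus.compModulus (Real.exp (-Real.pi)) = 1 / √2 ∧
    -- `A(k')` and `B(k')` are the extremal temperatures at time one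
    (∀ α : ℝ, 0 < α →
      IsLeast (RectTorus.temperatures α 1)
        (RectTorus.A (RectTorus.compModulus (Real.exp (-Real.pi * α ^ 2)))) ∧
      IsGreatest (RectTorus.temperatures α 1)
        (RectTorus.B (RectTorus.compModulus (Real.exp (-Real.pi * α ^ 2))))) ∧
    -- the square torus is the unique optimizer
    (∀ α : ℝ, 0 < α →
      RectTorus.minTemp α 1 ≤ RectTorus.minTemp 1 1 ∧
      RectTorus.maxTemp α 1 ≥ RectTorus.maxTemp 1 1 ∧
      (RectTorus.minTemp α 1 = RectTorus.minTemp 1 1 ↔ α = 1) ∧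
      (RectTorus.maxTemp α 1 = RectTorus.maxTemp 1 1 ↔ α = 1)) := by
  have hA : ∀ k' ∈ Set.Ioo (0 : ℝ) 1, RectTorus.A k' ≤ RectTorus.A (1 / √2) ∧
      (RectTorus.A k' = RectTorus.A (1 / √2) ↔ k' = 1 / √2) := by
    intro k' hk
    by_cases h : k' = 1 / √2
    · simp [h]
    · have := RectTorus.A_lt hk h
      exact ⟨this.le, by simp only [this.ne, h]⟩
  have hB : ∀ k' ∈ Set.Ioo (0 : ℝ) 1, RectTorus.B k' ≥ RectTorus.B (1 / √2) ∧
      (RectTorus.B k' = RectTorus.B (1 / √2) ↔ k' = 1 / √2) := by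
    intro k' hk
    by_cases h : k' = 1 / √2
    · simp [h]
    · have := RectTorus.lt_B hk h
      exact ⟨this.le, by simp only [this.ne', h]⟩
  have hself : ∀ k' : ℝ, k' = 1 / √2 ↔ k' = √(1 - k' ^ 2) ∧ k' = 1 / √2 := fun k' =>
    ⟨fun h => ⟨h ▸ RectTorus.one_div_sqrt_two_eq_sqrt, h⟩, And.right⟩
  refine ⟨fun k' hk => ⟨(hA k' hk).1, (hB k' hk).1, (hA k' hk).2.trans (hself k'),
    (hB k' hk).2.trans (hself k')⟩, RectTorus.bijOn_compModulus, RectTorus.compModulus_exp_neg_pi,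
    fun α hα => ⟨RectTorus.isLeast_temperatures hα, RectTorus.isGreatest_temperatures hα⟩,
    fun α hα => ?_⟩
  have hmem := RectTorus.bijOn_compModulus.mapsTo (Set.mem_Ioi.mpr hα)
  have h1 : RectTorus.compModulus (Real.exp (-Real.pi * 1 ^ 2)) = 1 / √2 := by
    rw [one_pow, mul_one, RectTorus.compModulus_exp_neg_pi]
  -- Injectivity of the parametrization carries the equality case from k' to α.
  have hiff : RectTorus.compModulus (Real.exp (-Real.pi * α ^ 2)) = 1 / √2 ↔ α = 1 := by
    rw [← h1]
    exact RectTorus.bijOn_compModulus.injOn.eq_iff (Set.mem_Ioi.mpr hα) (Set.mem_Ioi.mpr one_pos)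
  rw [RectTorus.minTemp_eq hα, RectTorus.maxTemp_eq hα, RectTorus.minTemp_eq one_pos,
    RectTorus.maxTemp_eq one_pos, h1]
  exact ⟨(hA _ hmem).1, (hB _ hmem).1, (hA _ hmem).2.trans hiff, (hB _ hmem).2.trans hiff⟩
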